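/- Let $G$ be a connected finite simple graph with vertex set $\{1,\dots,n\}$ and edge set $E(G)$. For $I\subseteq\{1,\dots,n\}$ let $E(I)$ denote the set of edges of $G$ with exactly one end in $I$, and let $d_G(i)$ denote the degree of the vertex $i$. A sequence $(r_1,\dots,r_n)$ of integers is the score vector of some orientation $D$ of $G$ (that is, each edge of $G$ is given exactly one of its two directions, and $r_i$ is the out-degree of $i$ in $D$ for every $i$) if and only if $$\sum_{i=1}^n r_i=|E(G)|\qquad\text{and}\qquad 2\sum_{i\in I} r_i\le |E(I)|+\sum_{i\in I} d_G(i)$$ for every set $\emptyset\ne I\subsetneq\{1,\dots,n\}$ such that the subgraphs of $G$ induced on $I$ and on $\{1,\dots,n\}\setminus I$ are both connected. In the case of complete graphs one has Landau's theorem: integers $r_1\le r_2\le\dots\le r_n$ are the scores (out-degrees of the vertices $1,\dots,n$) of some tournament, i.e. of some orientation of the complete graph on $\{1,\dots,n\}$, if and only if $\sum_{i=1}^n r_i=\binom n2$ and $\sum_{i=1}^k r_i\ge\binom k2$ for all $1\le k<n$. -/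

import Mathlib

open Finset

/-- `D` is an orientation of the simple graph `G`: every edge of `G` is given exactly one of its
two directions, and `D` has no other arcs (in particular no loops). -/
def Digraph.IsOrientationOf {V : Type*} (D : Digraph V) (G : SimpleGraph V) : Prop :=
  (∀ u v, G.Adj u v ↔ D.Adj u v ∨ D.Adj v u) ∧ ∀ u v, D.Adj u v → ¬ D.Adj v u

open Classical in
/-- The out-degree of `v` in `D`: the number of arcs with tail `v`. -/
noncomputable def Digraph.outDegree {V : Type*} [Fintype V] (D : Digraph V) (v : V) : ℕ :=
  #{w | D.Adj v w}

/-- The integer vector `r` is the score vector of `D`: its entries are the out-degrees of `D`. -/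
def Digraph.IsScoreVector {V : Type*} [Fintype V] (D : Digraph V) (r : V → ℤ) : Prop :=
  ∀ v, r v = D.outDegree v

/-- The set of edges of `G` with exactly one end in `I`. -/
def SimpleGraph.edgeCut {V : Type*} [Fintype V] [DecidableEq V] (G : SimpleGraph V)
    [DecidableRel G.Adj] (I : Finset V) : Finset (Sym2 V) :=
  {e ∈ G.edgeFinset | ∃ u ∈ I, ∃ v ∉ I, e = s(u, v)}

/-! Since |E(I)| + ∑_{i∈I} d(i) is twice the number of edges meeting I, the condition says that r(I)
is at most that number; arcs with tail in I show necessity. Given the total, this amounts to r(J) ≥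
#edges within J for J = Iᶜ. Both bounds pass from components to unions, so take J connected and
split Jᶜ into components; each has connected complement, so the hypothesis applies
(`Connected.card_edgesWithin_le_sum`). Hall's theorem then assigns each edge one of r(v) slots at an
end v, its tail. For complete graphs the lower bound is C(|J|, 2), and monotonicity makes initial
segments the worst case. -/

namespace SimpleGraph

variable {V : Type*} {G : SimpleGraph V}

/-- In a preconnected graph, an edge leaves every vertex set that separates two vertices. -/
lemma Preconnected.exists_adj_mem_not_mem (h : G.Preconnected) {S : Set V} {u v : V}
    (hu : u ∈ S) (hv : v ∉ S) : ∃ x ∈ S, ∃ y ∉ S, G.Adj x y := by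
  obtain ⟨p⟩ := h u v
  obtain ⟨d, -, h1, h2⟩ := p.exists_boundary_dart S hu hv
  exact ⟨d.fst, h1, d.snd, h2, d.adj⟩

lemma Preconnected.exists_adj_mem_not_mem_of_induce {I : Set V} (h : (G.induce I).Preconnected)
    {S : Set V} {u v : V} (huI : u ∈ I) (hvI : v ∈ I) (hu : u ∈ S) (hv : v ∉ S) :
    ∃ x ∈ I, x ∈ S ∧ ∃ y ∈ I, y ∉ S ∧ G.Adj x y := by
  obtain ⟨x, hx, y, hy, hxy⟩ := h.exists_adj_mem_not_mem (S := Subtype.val ⁻¹' S)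
    (u := ⟨u, huI⟩) (v := ⟨v, hvI⟩) hu hv
  exact ⟨x, x.2, hx, y, y.2, hy, hxy⟩

/-! ### Components of induced subgraphs -/

section Components

variable [DecidableEq V]

/-- The component of `v` in the subgraph induced on `U`. -/
lemma exists_induced_component {U : Finset V} {v : V} (hv : v ∈ U) :
    ∃ C ⊆ U, v ∈ C ∧ (G.induce (C : Set V)).Connected ∧
      ∀ x ∈ C, ∀ y ∈ U \ C, ¬ G.Adj x y := by
  classical
  let F : Finset (Finset V) := {C ∈ U.powerset | v ∈ C ∧ (G.induce (C : Set V)).Connected}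
  have hF : ∀ C, C ∈ F ↔ C ⊆ U ∧ v ∈ C ∧ (G.induce (C : Set V)).Connected := by simp [F]
  have hne : F.Nonempty := by
    refine ⟨{v}, (hF _).2 ⟨by simpa using hv, by simp, ?_⟩⟩
    rw [coe_singleton, induce_singleton_eq_top]
    exact connected_top
  obtain ⟨C, hC⟩ := F.exists_maximal hne
  obtain ⟨hCU, hvC, hconn⟩ := (hF C).1 hC.1
  refine ⟨C, hCU, hvC, hconn, fun x hx y hy hxy ↦ ?_⟩
  rw [mem_sdiff] at hy
  have hD : insert y C ∈ F := by
    refine (hF _).2 ⟨insert_subset hy.1 hCU, mem_insert_of_mem hvC, ?_⟩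
    have := connected_induce_union (G := G) (s := {y}) (t := C) (v := y) (w := x)
      (by rw [induce_singleton_eq_top]; exact connected_top.preconnected) hconn.preconnected
      rfl hx hxy.symm
    rwa [coe_insert, Set.insert_eq]
  exact hy.2 (hC.2 hD (subset_insert y C) (mem_insert_self y C))

/-- A property of vertex sets that is preserved by unions of disjoint sets without edges between
them passes from the components of an induced subgraph to its vertex set. -/
lemma induction_on_components (G : SimpleGraph V) {P : Finset V → Prop} (S : Finset V)
    (empty : P ∅)
    (union : ∀ A B, Disjoint A B → (∀ x ∈ A, ∀ y ∈ B, ¬ G.Adj x y) → P A → P B → P (A ∪ B))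
    (component : ∀ C ⊆ S, (G.induce (C : Set V)).Connected →
      (∀ x ∈ C, ∀ y ∈ S \ C, ¬ G.Adj x y) → P C) : P S := by
  -- Such a U is a union of components of S, so components of U are components of S.
  suffices ∀ U ⊆ S, (∀ x ∈ U, ∀ y ∈ S \ U, ¬ G.Adj x y) → P U from
    this S subset_rfl (by simp)
  intro U
  induction U using Finset.strongInduction with
  | H U ih =>
    intro hUS hU
    obtain rfl | ⟨v, hv⟩ := U.eq_empty_or_nonempty
    · exact empty
    obtain ⟨C, hCU, hvC, hconn, hC⟩ := exists_induced_component (G := G) hv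
    have hCS : ∀ x ∈ C, ∀ y ∈ S \ C, ¬ G.Adj x y := fun x hx y hy ↦ by
      by_cases hyU : y ∈ U
      · exact hC x hx y (mem_sdiff.2 ⟨hyU, (mem_sdiff.1 hy).2⟩)
      · exact hU x (hCU hx) y (mem_sdiff.2 ⟨(mem_sdiff.1 hy).1, hyU⟩)
    have hrest : P (U \ C) := by
      refine ih _ (sdiff_ssubset hCU ⟨v, hvC⟩) (sdiff_subset.trans hUS) fun x hx y hy hxy ↦ ?_
      by_cases hyC : y ∈ C
      · exact hC y hyC x hx hxy.symm
      · refine hU x (mem_sdiff.1 hx).1 y (mem_sdiff.2 ⟨(mem_sdiff.1 hy).1, fun hyU ↦ ?_⟩) hxy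
        exact (mem_sdiff.1 hy).2 (mem_sdiff.2 ⟨hyU, hyC⟩)
    rw [← union_sdiff_of_subset hCU]
    exact union _ _ disjoint_sdiff hC (component C (hCU.trans hUS) hconn hCS) hrest

/-- Removing from a connected graph a component of the complement of a connected vertex set leaves
a connected graph. -/
lemma Connected.induce_compl_component [Fintype V] (hG : G.Connected) {I C : Finset V}
    (hI : (G.induce (I : Set V)).Connected) (hCI : C ⊆ Iᶜ)
    (hC : ∀ x ∈ C, ∀ y ∈ Iᶜ \ C, ¬ G.Adj x y) :
    (G.induce ((Cᶜ : Finset V) : Set V)).Connected := by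
  obtain ⟨⟨v, hvI⟩⟩ := hI.nonempty
  rw [mem_coe] at hvI
  have hIC : ∀ x ∈ I, x ∈ Cᶜ := fun x hx ↦ mem_compl.2 fun hxC ↦ mem_compl.1 (hCI hxC) hx
  obtain ⟨K, hKC, hvK, hKconn, hK⟩ := exists_induced_component (G := G) (hIC v hvI)
  have hIK : ∀ x ∈ I, x ∈ K := by
    by_contra! ⟨w, hwI, hwK⟩
    obtain ⟨x, -, hxK, y, hyI, hyK, hxy⟩ :=
      hI.preconnected.exists_adj_mem_not_mem_of_induce (S := (K : Set V)) hvI hwI hvK hwK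
    exact hK x hxK y (mem_sdiff.2 ⟨hIC y hyI, hyK⟩) hxy
  -- A further part of Cᶜ would avoid I, hence have no edge to C, and none to K: G would be
  -- disconnected.
  suffices Cᶜ ⊆ K by rwa [← hKC.antisymm this]
  intro w hw
  by_contra hwK
  obtain ⟨x, hx, y, hy, hxy⟩ := hG.preconnected.exists_adj_mem_not_mem
    (S := ((Cᶜ \ K : Finset V) : Set V)) (mem_sdiff.2 ⟨hw, hwK⟩) (v := v)
    (fun h ↦ (mem_sdiff.1 h).2 hvK)
  have hx' := mem_sdiff.1 (mem_coe.1 hx)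
  by_cases hyC : y ∈ C
  · exact hC y hyC x (mem_sdiff.2 ⟨mem_compl.2 fun h ↦ hx'.2 (hIK x h),
      mem_compl.1 hx'.1⟩) hxy.symm
  · refine hK y ?_ x (mem_coe.1 hx) hxy.symm
    by_contra hyK
    exact hy (mem_sdiff.2 ⟨mem_compl.2 hyC, hyK⟩)

end Components

/-! ### Edge counts and reduction to connected sets -/

section Edges

variable [Fintype V] [DecidableEq V] (G : SimpleGraph V) [DecidableRel G.Adj]

/-- The edges of `G` with both ends in `I`. -/
def edgesWithin (I : Finset V) : Finset (Sym2 V) := G.edgeFinset ∩ I.sym2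

/-- The edges of `G` with at least one end in `I`. -/
def edgesMeeting (I : Finset V) : Finset (Sym2 V) := G.edgeFinset \ Iᶜ.sym2

variable {G} {I : Finset V}

@[simp] lemma mk_mem_edgesWithin {u v : V} :
    s(u, v) ∈ G.edgesWithin I ↔ G.Adj u v ∧ u ∈ I ∧ v ∈ I := by
  simp [edgesWithin]

@[simp] lemma mk_mem_edgesMeeting {u v : V} :
    s(u, v) ∈ G.edgesMeeting I ↔ G.Adj u v ∧ (u ∈ I ∨ v ∈ I) := by
  simp [edgesMeeting, -not_and, not_and_or]

@[simp] lemma mk_mem_edgeCut {u v : V} :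
    s(u, v) ∈ G.edgeCut I ↔ G.Adj u v ∧ (u ∈ I ∧ v ∉ I ∨ v ∈ I ∧ u ∉ I) := by
  simp only [edgeCut, mem_filter, mem_edgeFinset, mem_edgeSet, Sym2.eq_iff]
  grind

variable (G I)

lemma card_edgesMeeting_add_card_edgesWithin_compl :
    #(G.edgesMeeting I) + #(G.edgesWithin Iᶜ) = #G.edgeFinset :=
  card_sdiff_add_card_inter _ _

lemma card_edgeCut_add_card_edgesWithin :
    #(G.edgeCut I) + #(G.edgesWithin I) = #(G.edgesMeeting I) := by
  rw [← card_union_of_disjoint]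
  · congr 1
    ext e
    induction e with | _ u v
    simp only [mem_union, mk_mem_edgeCut, mk_mem_edgesWithin, mk_mem_edgesMeeting]
    grind
  · rw [Finset.disjoint_left]
    intro e
    induction e with | _ u v
    simp only [mk_mem_edgeCut, mk_mem_edgesWithin]
    grind

/-- Double counting: an edge contributes once per end in I. -/
lemma sum_degree_eq_card_edgesMeeting_add_card_edgesWithin :
    ∑ i ∈ I, G.degree i = #(G.edgesMeeting I) + #(G.edgesWithin I) := by
  have hM : G.edgesMeeting I = {e ∈ G.edgeFinset | e ∈ G.edgesMeeting I} := by
    ext e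
    simp only [mem_filter, iff_and_self]
    exact fun h ↦ (mem_sdiff.1 h).1
  have hW : G.edgesWithin I = {e ∈ G.edgeFinset | e ∈ G.edgesWithin I} := by
    ext e
    simp only [mem_filter, iff_and_self]
    exact fun h ↦ (mem_inter.1 h).1
  simp_rw [← card_incidenceFinset_eq_degree, incidenceFinset_eq_filter]
  rw [hM, hW]
  simp_rw [card_filter]
  rw [sum_comm, ← sum_add_distrib]
  refine sum_congr rfl fun e he ↦ ?_
  induction e with | _ u v
  rw [mem_edgeFinset, mem_edgeSet] at he
  have huv : u ≠ v := he.ne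
  have h : ∀ x, (if x ∈ s(u, v) then 1 else 0) =
      (if x = u then 1 else 0) + (if x = v then 1 else 0) := by
    intro x
    simp only [Sym2.mem_iff]
    split_ifs <;> grind
  simp_rw [h, sum_add_distrib, sum_ite_eq', mk_mem_edgesMeeting, mk_mem_edgesWithin]
  split_ifs <;> grind

lemma card_edgeCut_add_sum_degree :
    #(G.edgeCut I) + ∑ i ∈ I, G.degree i = 2 * #(G.edgesMeeting I) := by
  have h1 := G.card_edgeCut_add_card_edgesWithin I
  have h2 := G.sum_degree_eq_card_edgesMeeting_add_card_edgesWithin I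
  lia

lemma edgesWithin_empty : G.edgesWithin ∅ = ∅ := by
  simp [edgesWithin]

lemma edgesMeeting_empty : G.edgesMeeting ∅ = ∅ := by
  simp [edgesMeeting]

lemma edgesWithin_univ : G.edgesWithin univ = G.edgeFinset := by
  simp [edgesWithin]

variable {G}

lemma card_edgesWithin_union_le {A B : Finset V} (h : ∀ x ∈ A, ∀ y ∈ B, ¬ G.Adj x y) :
    #(G.edgesWithin (A ∪ B)) ≤ #(G.edgesWithin A) + #(G.edgesWithin B) := by
  refine (card_le_card fun e he ↦ ?_).trans (card_union_le _ _)
  induction e with | _ u v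
  simp only [mem_union, mk_mem_edgesWithin] at he ⊢
  grind [G.adj_comm u v]

lemma card_edgesMeeting_union {A B : Finset V} (hAB : Disjoint A B)
    (h : ∀ x ∈ A, ∀ y ∈ B, ¬ G.Adj x y) :
    #(G.edgesMeeting (A ∪ B)) = #(G.edgesMeeting A) + #(G.edgesMeeting B) := by
  rw [← card_union_of_disjoint]
  · congr 1
    ext e
    induction e with | _ u v
    simp only [mem_union, mk_mem_edgesMeeting]
    tauto
  · rw [Finset.disjoint_left] at hAB ⊢
    intro e
    induction e with | _ u v
    simp only [mk_mem_edgesMeeting]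
    grind [G.adj_comm u v]

lemma card_edgesWithin_top (I : Finset V) :
    #((⊤ : SimpleGraph V).edgesWithin I) = (#I).choose 2 := by
  rw [← Sym2.card_image_offDiag]
  congr 1
  ext e
  induction e with | _ u v
  simp only [mk_mem_edgesWithin, top_adj, mem_image, mem_offDiag, Prod.exists]
  constructor
  · rintro ⟨h, hu, hv⟩
    exact ⟨u, v, ⟨hu, hv, h⟩, rfl⟩
  · rintro ⟨a, b, ⟨ha, hb, hab⟩, h⟩
    rcases Sym2.eq_iff.1 h with ⟨rfl, rfl⟩ | ⟨rfl, rfl⟩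
    · exact ⟨hab, ha, hb⟩
    · exact ⟨hab.symm, hb, ha⟩

/-- For a connected graph, the upper bounds for connected sets with connected complement imply
the lower bounds for all sets. -/
lemma Connected.card_edgesWithin_le_sum (hG : G.Connected) {r : V → ℤ}
    (hsum : ∑ i, r i = #G.edgeFinset)
    (h : ∀ I : Finset V, I.Nonempty → I ≠ univ → (G.induce (I : Set V)).Connected →
      (G.induce ((Iᶜ : Finset V) : Set V)).Connected → ∑ i ∈ I, r i ≤ #(G.edgesMeeting I))
    (I : Finset V) : (#(G.edgesWithin I) : ℤ) ≤ ∑ i ∈ I, r i := by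
  refine induction_on_components G (P := fun I ↦ (#(G.edgesWithin I) : ℤ) ≤ ∑ i ∈ I, r i) I
    (by simp [edgesWithin_empty]) (fun A B hAB hadj hA hB ↦ ?_) fun I _ hI _ ↦ ?_
  · rw [sum_union hAB]
    have := card_edgesWithin_union_le hadj
    lia
  · have hc : ∑ i ∈ Iᶜ, r i ≤ #(G.edgesMeeting Iᶜ) := by
      refine induction_on_components G (P := fun J ↦ ∑ i ∈ J, r i ≤ #(G.edgesMeeting J)) Iᶜ
        (by simp [edgesMeeting_empty]) (fun A B hAB hadj hA hB ↦ ?_) fun C hCI hconn hC ↦ ?_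
      · rw [sum_union hAB, card_edgesMeeting_union hAB hadj]
        push_cast
        exact add_le_add hA hB
      · obtain ⟨⟨v, hvC⟩⟩ := hconn.nonempty
        obtain ⟨⟨w, hwI⟩⟩ := hI.nonempty
        refine h C ⟨v, hvC⟩ ?_ hconn (hG.induce_compl_component hI hCI hC)
        rintro rfl
        exact mem_compl.1 (hCI (mem_univ w)) hwI
    have h1 := G.card_edgesMeeting_add_card_edgesWithin_compl Iᶜ
    have h2 := sum_add_sum_compl I r
    rw [compl_compl] at h1
    lia

end Edges

end SimpleGraph

/-! ### Necessity: arcs versus edges -/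

namespace Digraph.IsOrientationOf

variable {V : Type*} [Fintype V] [DecidableEq V] {G : SimpleGraph V} [DecidableRel G.Adj]
  {D : Digraph V}

-- Sending an arc to its edge is injective because no edge carries both directions.
open Classical in
lemma sum_outDegree_le (hD : D.IsOrientationOf G) (I : Finset V) :
    ∑ v ∈ I, D.outDegree v ≤ #(G.edgesMeeting I) := by
  have : ∑ v ∈ I, D.outDegree v = #(I.sigma fun v ↦ {w | D.Adj v w}) := by
    rw [card_sigma]
    exact sum_congr rfl fun v _ ↦ by unfold Digraph.outDegree; congr!
  rw [this]
  refine card_le_card_of_injOn (fun p ↦ s(p.1, p.2)) ?_ ?_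
  · rintro ⟨u, v⟩ h
    simp only [coe_sigma, Set.mem_sigma_iff, mem_coe, mem_filter, mem_univ, true_and] at h
    simp only [mem_coe, SimpleGraph.mk_mem_edgesMeeting]
    exact ⟨(hD.1 u v).2 (.inl h.2), .inl h.1⟩
  · rintro ⟨u, v⟩ h ⟨u', v'⟩ h' heq
    simp only [coe_sigma, Set.mem_sigma_iff, mem_coe, mem_filter, mem_univ, true_and] at h h'
    rcases Sym2.eq_iff.1 heq with ⟨rfl, rfl⟩ | ⟨rfl, rfl⟩
    · rfl
    · exact absurd h'.2 (hD.2 _ _ h.2)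

open Classical in
lemma sum_outDegree (hD : D.IsOrientationOf G) : ∑ v, D.outDegree v = #G.edgeFinset := by
  refine le_antisymm ((hD.sum_outDegree_le univ).trans (card_le_card sdiff_subset)) ?_
  have : ∑ v, D.outDegree v = #(univ.sigma fun v ↦ ({w | D.Adj v w} : Finset V)) := by
    rw [card_sigma]
    exact sum_congr rfl fun v _ ↦ by unfold Digraph.outDegree; congr!
  rw [this]
  refine card_le_card_of_surjOn (fun p ↦ s(p.1, p.2)) fun e he ↦ ?_
  induction e with | _ u v
  rw [mem_coe, SimpleGraph.mem_edgeFinset, SimpleGraph.mem_edgeSet] at he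
  rcases (hD.1 u v).1 he with h | h
  · exact ⟨⟨u, v⟩, by simpa using h, rfl⟩
  · exact ⟨⟨v, u⟩, by simpa using h, Sym2.eq_swap⟩

end Digraph.IsOrientationOf

/-! ### Sufficiency via Hall's theorem -/

namespace SimpleGraph

variable {V : Type*} [Fintype V] [DecidableEq V] {G : SimpleGraph V} [DecidableRel G.Adj]

/-- Hakimi's criterion for score vectors of orientations, the sufficiency part. -/
lemma exists_orientation_of_card_edgesWithin_le_sum {r : V → ℤ}
    (hsum : ∑ i, r i = #G.edgeFinset)
    (h : ∀ I : Finset V, (#(G.edgesWithin I) : ℤ) ≤ ∑ i ∈ I, r i) :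
    ∃ D : Digraph V, D.IsOrientationOf G ∧ D.IsScoreVector r := by
  classical
  have hr : ∀ v, ((r v).toNat : ℤ) = r v := fun v ↦ Int.toNat_of_nonneg <| by
    simpa using (Nat.cast_nonneg _).trans (h {v})
  let t : G.edgeFinset → Finset (Σ _ : V, ℕ) :=
    fun e ↦ ({v | v ∈ e.1} : Finset V).sigma fun v ↦ range (r v).toNat
  have hall : ∀ s : Finset G.edgeFinset, #s ≤ #(s.biUnion t) := by
    intro s
    -- The slots available to s number r(I), and s lies within I, so the lower bound is Hall's
    -- condition.
    let I : Finset V := {v | ∃ e ∈ s, v ∈ e.1}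
    have hI : s.biUnion t = I.sigma fun v ↦ range (r v).toNat := by
      ext ⟨v, k⟩
      simp only [t, I, mem_biUnion, mem_sigma, mem_filter, mem_univ, true_and]
      grind
    have hs : #s ≤ #(G.edgesWithin I) := by
      rw [← card_map (Function.Embedding.subtype _)]
      refine card_le_card fun e he ↦ ?_
      obtain ⟨e, hes, rfl⟩ := mem_map.1 he
      refine mem_inter.2 ⟨e.2, mem_sym2_iff.2 fun v hv ↦ ?_⟩
      exact mem_filter.2 ⟨mem_univ v, e, hes, hv⟩
    have := h I
    rw [hI, card_sigma]
    simp only [card_range]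
    zify
    simp only [hr]
    lia
  obtain ⟨f, hinj, hf⟩ := (all_card_le_biUnion_card_iff_exists_injective t).1 hall
  have hft : ∀ e, (f e).1 ∈ e.1 ∧ (f e).2 < (r (f e).1).toNat := fun e ↦ by
    simpa [t] using hf e
  let D : Digraph V := ⟨fun u v ↦ ∃ e : G.edgeFinset, e.1 = s(u, v) ∧ (f e).1 = u⟩
  have hDadj : ∀ u v, D.Adj u v ↔ ∃ e : G.edgeFinset, e.1 = s(u, v) ∧ (f e).1 = u :=
    fun _ _ ↦ Iff.rfl
  have hG : ∀ u v, D.Adj u v → G.Adj u v := by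
    rintro u v ⟨e, he, -⟩
    simpa [he] using e.2
  have hD : D.IsOrientationOf G := by
    refine ⟨fun u v ↦ ⟨fun huv ↦ ?_, ?_⟩, ?_⟩
    · have he : s(u, v) ∈ G.edgeFinset := by simpa using huv
      rcases Sym2.mem_iff.1 (hft ⟨_, he⟩).1 with h1 | h1
      · exact .inl ⟨⟨_, he⟩, rfl, h1⟩
      · exact .inr ⟨⟨_, he⟩, Sym2.eq_swap, h1⟩
    · rintro (huv | huv)
      · exact hG u v huv
      · exact (hG v u huv).symm
    · rintro u v huv ⟨e', he', h'⟩
      have hne := (hG u v huv).ne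
      obtain ⟨e, he, h1⟩ := huv
      obtain rfl : e = e' := Subtype.ext (he.trans (Sym2.eq_swap.trans he'.symm))
      exact hne (h1.symm.trans h')
  refine ⟨D, hD, ?_⟩
  -- Arcs out of v occupy distinct slots at v; equality follows from the equal totals.
  have hle : ∀ v, (D.outDegree v : ℤ) ≤ r v := by
    intro v
    rw [← hr v, Nat.cast_le]
    -- `choose!` needs a default edge for non-neighbours of v.
    obtain hempty | _ := isEmpty_or_nonempty G.edgeFinset
    · have : ∀ w, ¬ D.Adj v w := fun w ⟨e, _⟩ ↦ hempty.elim e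
      simp [Digraph.outDegree, this]
    choose! g hg using fun w (hw : D.Adj v w) ↦ (hDadj v w).1 hw
    rw [← card_range (r v).toNat]
    refine card_le_card_of_injOn (fun w ↦ (f (g w)).2) ?_ ?_
    · intro w hw
      have hw : D.Adj v w := by simpa using hw
      have := (hft (g w)).2
      rw [(hg w hw).2] at this
      simpa using this
    · intro w hw w' hw' heq
      have hw : D.Adj v w := by simpa using hw
      have hw' : D.Adj v w' := by simpa using hw'
      have hgg : g w = g w' :=
        hinj (Sigma.ext ((hg w hw).2.trans (hg w' hw').2.symm) (heq_of_eq heq))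
      have := (hg w hw).1.symm.trans ((congrArg Subtype.val hgg).trans (hg w' hw').1)
      exact Sym2.congr_right.1 this
  have htot : ∑ v, (D.outDegree v : ℤ) = ∑ v, r v := by
    rw [hsum]
    exact_mod_cast hD.sum_outDegree
  intro v
  exact (((sum_eq_sum_iff_of_le fun v _ ↦ hle v).1 htot) v (mem_univ v)).symm

end SimpleGraph

/-! ### Monotone vectors and the main theorem -/

/-- The sum of a monotone vector over any `k`-set is at least the sum of its first `k` entries. -/
lemma Monotone.sum_filter_val_lt_card_le {n : ℕ} {r : Fin n → ℤ} (hr : Monotone r)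
    (I : Finset (Fin n)) : ∑ i : Fin n with i.val < #I, r i ≤ ∑ i ∈ I, r i := by
  set P : Finset (Fin n) := {i | i.val < #I} with hP
  have hcard : #P = #I := by
    have hle : #I ≤ n := by simpa using card_le_univ I
    rw [hP, Fin.card_filter_val_lt, min_eq_right hle]
  have hdiff : #(P \ I) = #(I \ P) := card_sdiff_comm hcard
  rw [← sum_sdiff_le_sum_sdiff]
  obtain he | ⟨a, ha⟩ := (P \ I).eq_empty_or_nonempty
  · rw [he, card_empty] at hdiff
    rw [he, card_eq_zero.1 hdiff.symm]
  · obtain ⟨m, hm, hmax⟩ := exists_max_image (P \ I) r ⟨a, ha⟩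
    have hmP : m.val < #I := (mem_filter.1 (mem_sdiff.1 hm).1).2
    calc ∑ i ∈ P \ I, r i ≤ #(P \ I) • r m := sum_le_card_nsmul _ _ _ hmax
      _ = #(I \ P) • r m := by rw [hdiff]
      _ ≤ ∑ i ∈ I \ P, r i := card_nsmul_le_sum _ _ _ fun i hi ↦ hr <| by
          have : ¬ i.val < #I := by simpa [hP] using (mem_sdiff.1 hi).2
          exact Fin.le_def.2 (by lia)

theorem corollary4p12 (n : ℕ) :
    (∀ (G : SimpleGraph (Fin n)) [DecidableRel G.Adj], G.Connected → ∀ r : Fin n → ℤ,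
      (∃ D : Digraph (Fin n), D.IsOrientationOf G ∧ D.IsScoreVector r) ↔
        (∑ i, r i = (#G.edgeFinset : ℤ) ∧
          ∀ I : Finset (Fin n), I.Nonempty → I ≠ univ →
            (G.induce (I : Set (Fin n))).Connected →
            (G.induce ((I : Set (Fin n))ᶜ)).Connected →
            2 * ∑ i ∈ I, r i ≤ (#(G.edgeCut I) : ℤ) + ∑ i ∈ I, (G.degree i : ℤ))) ∧
    (∀ r : Fin n → ℤ, Monotone r →
      ((∃ D : Digraph (Fin n), D.IsOrientationOf (⊤ : SimpleGraph (Fin n)) ∧ D.IsScoreVector r) ↔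
        (∑ i, r i = (n.choose 2 : ℤ) ∧
          ∀ k : ℕ, 1 ≤ k → k < n →
            (k.choose 2 : ℤ) ≤ ∑ i : Fin n with i.val < k, r i))) := by
  refine ⟨fun G _ hG r ↦ ?_, fun r hr ↦ ?_⟩
  · have hcut : ∀ I : Finset (Fin n), (#(G.edgeCut I) : ℤ) + ∑ i ∈ I, (G.degree i : ℤ) =
        2 * #(G.edgesMeeting I) := fun I ↦ mod_cast G.card_edgeCut_add_sum_degree I
    simp only [hcut]
    constructor
    · rintro ⟨D, hD, hs⟩
      have hs : ∀ v, r v = D.outDegree v := hs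
      simp only [hs]
      exact ⟨mod_cast hD.sum_outDegree, fun I _ _ _ _ ↦ mod_cast
        Nat.mul_le_mul_left 2 (hD.sum_outDegree_le I)⟩
    · rintro ⟨hsum, h⟩
      refine SimpleGraph.exists_orientation_of_card_edgesWithin_le_sum hsum
        (hG.card_edgesWithin_le_sum hsum fun I hne huniv hI hIc ↦ ?_)
      rw [coe_compl] at hIc
      have := h I hne huniv hI hIc
      lia
  · have htop : #(⊤ : SimpleGraph (Fin n)).edgeFinset = n.choose 2 := by
      rw [← SimpleGraph.edgesWithin_univ, SimpleGraph.card_edgesWithin_top, card_univ,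
        Fintype.card_fin]
    constructor
    · rintro ⟨D, hD, hs⟩
      have hs : ∀ v, r v = D.outDegree v := hs
      have hsum : ∑ i, r i = (n.choose 2 : ℤ) := by
        simp only [hs]
        rw [← htop]
        exact_mod_cast hD.sum_outDegree
      refine ⟨hsum, fun k _ hkn ↦ ?_⟩
      set P : Finset (Fin n) := {i | i.val < k} with hP
      have hcard : #P = k := by rw [hP, Fin.card_filter_val_lt, min_eq_right hkn.le]
      have h1 := (⊤ : SimpleGraph (Fin n)).card_edgesMeeting_add_card_edgesWithin_compl Pᶜ
      rw [compl_compl, SimpleGraph.card_edgesWithin_top, hcard, htop] at h1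
      have h2 : ∑ i ∈ Pᶜ, r i ≤ #((⊤ : SimpleGraph (Fin n)).edgesMeeting Pᶜ) := by
        simp only [hs]
        exact_mod_cast hD.sum_outDegree_le Pᶜ
      have h3 := sum_add_sum_compl P r
      lia
    · rintro ⟨hsum, h⟩
      refine SimpleGraph.exists_orientation_of_card_edgesWithin_le_sum (by rw [htop, hsum])
        fun I ↦ ?_
      rw [SimpleGraph.card_edgesWithin_top]
      refine le_trans ?_ (hr.sum_filter_val_lt_card_le I)
      have hle : #I ≤ n := by simpa using card_le_univ I
      -- The hypothesis covers only 1 ≤ k < n; k = 0 is trivial and k = n is the total.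
      obtain h0 | h0 := Nat.eq_zero_or_pos #I
      · simp [h0]
      obtain hlt | heq := hle.lt_or_eq
      · exact h _ h0 hlt
      · simp [heq, hsum]
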